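/- Let $\beta>1$ and $L>0$. For $f:[0,1]\to\mathbb R$ in $L^2([0,1])$ put $r=\lfloor\beta\rfloor+1$, $\Delta_h^r f(x)=\sum_{k=0}^r\binom rk(-1)^{r-k}f(x+kh)$ for $x\in A_h^r=\{x\in[0,1]:x+rh\in[0,1]\}$, $$\omega_r(f,t)=\sup_{|h|\le t}\|\Delta_h^r f\|_{L^2(A_h^r)},\qquad \|f\|_{\mathcal B^\beta_{2,\infty}}=\sup_{t>0}t^{-\beta}\omega_r(f,t)+\|f\|_{L^2([0,1])},$$ and let $\mathcal B^\beta_{2,\infty}([0,1],L)$ be the set of $f\in L^2([0,1])$ with $\|f\|_{\mathcal B^\beta_{2,\infty}}\le L$. Let $(Y_i,T_i)_{i=1,\dots,n}$ be i.i.d., with $Y_i$ and $T_i$ independent positive random variables, and let $F$ be the c.d.f. of $Y_i$. Only the current status sample $(T_i,\delta_i)_{i=1,\dots,n}$, with $\delta_i=\mathbf 1_{\{Y_i\le T_i\}}$, is observed. Then there is a constant $c>0$, depending only on $\beta$ and $L$, such that for every distribution of $T_i$ on $(0,\infty)$ and every $n\ge1$, $$\inf_{\widehat F_n}\ \sup_{F}\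 \mathbb E\big[\|\widehat F_n-F\|_{L^2([0,1])}^2\big]\ \ge\ c\,n^{-2\beta/(2\beta+1)},$$ where the supremum is over all c.d.f.s $F$ of positive random variables whose restriction to $[0,1]$ lies in $\mathcal B^\beta_{2,\infty}([0,1],L)$, and the infimum is over all (jointly measurable) estimators $\widehat F_n=\widehat F_n(\cdot\,;(T_i,\delta_i)_{i\le n})$. -/

import Mathlib

open MeasureTheory ProbabilityTheory
open scoped ENNReal

namespace CurrentStatus

noncomputable section

/-! ### One-dimensional Besov balls `B^β_{2,∞}(A, L)` -/

/-- The points at which the `r`-th order difference with step `h` only involves points of the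
interval `A`. -/
def diffDomain (r : ℕ) (h : ℝ) (A : Set ℝ) : Set ℝ :=
  {x | x ∈ A ∧ x + r * h ∈ A}

/-- The `L²` modulus of smoothness of order `r` on `A`: the supremum over `|h| ≤ t` of the `L²` norm
on `diffDomain r h A` of the `r`-th difference
`x ↦ ∑ k ∈ {0, …, r}, (-1) ^ (r - k) * (r choose k) * f (x + k h)`
(`fwdDiff_iter_eq_sum_shift`). -/
def modulus (r : ℕ) (f : ℝ → ℝ) (t : ℝ) (A : Set ℝ) : ℝ≥0∞ :=
  ⨆ (h : ℝ) (_ : |h| ≤ t), eLpNorm ((fwdDiff h)^[r] f) 2 (volume.restrict (diffDomain r h A))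

/-- The Besov seminorm `sup_{t > 0} t^{-β} ω_r(f, t, A)` with `r = ⌊β⌋ + 1`. -/
def besovSeminorm (β : ℝ) (A : Set ℝ) (f : ℝ → ℝ) : ℝ≥0∞ :=
  ⨆ (t : ℝ) (_ : 0 < t), ENNReal.ofReal (t ^ (-β)) * modulus (⌊β⌋₊ + 1) f t A

/-- The Besov norm of `B^β_{2,∞}(A)`, as an extended nonnegative real. -/
def besovNorm (β : ℝ) (A : Set ℝ) (f : ℝ → ℝ) : ℝ≥0∞ :=
  besovSeminorm β A f + eLpNorm f 2 (volume.restrict A)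

/-- The Besov ball `B^β_{2,∞}(A, L)`. -/
def besovBall (β : ℝ) (A : Set ℝ) (L : ℝ) : Set (ℝ → ℝ) :=
  {f | MemLp f 2 (volume.restrict A) ∧ besovNorm β A f ≤ ENNReal.ofReal L}

/-! ### The current status model without covariate -/

/-- The laws `μ` of a positive random variable `Y` whose c.d.f. belongs to
`B^β_{2,∞}([0,1], L)`. -/
def lawClass (β L : ℝ) : Set (ProbabilityMeasure ℝ) :=
  {μ | (∀ᵐ y ∂(μ : Measure ℝ), 0 < y) ∧
    (fun u : ℝ => cdf (μ : Measure ℝ) u) ∈ besovBall β (Set.Icc 0 1) L}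

/-- The law of `n` i.i.d. copies of `(Y, T)` with `Y ∼ μ` and `T ∼ ν` independent. -/
def fullLaw (n : ℕ) (μ ν : ProbabilityMeasure ℝ) : Measure (Fin n → ℝ × ℝ) :=
  Measure.pi fun _ => (μ : Measure ℝ).prod (ν : Measure ℝ)

/-- The observed sample `(Tᵢ, δᵢ)`, where `δᵢ` is the truth value of `Yᵢ ≤ Tᵢ`, as a function of
the unobserved full sample `(Yᵢ, Tᵢ)`. -/
def observe {n : ℕ} (ω : Fin n → ℝ × ℝ) : Fin n → ℝ × Bool :=
  fun i => ((ω i).2, decide ((ω i).1 ≤ (ω i).2))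

/-- The risk `E ‖F̂ₙ - F‖²`, with `‖·‖` the norm of `L²([0,1])`, of an estimator `Fhat`
based on the observed sample, when `Y ∼ μ` (with c.d.f. `F`) and `T ∼ ν`. -/
def risk (n : ℕ) (μ ν : ProbabilityMeasure ℝ) (Fhat : (Fin n → ℝ × Bool) → ℝ → ℝ) : ℝ≥0∞ :=
  ∫⁻ ω, ∫⁻ u in Set.Icc (0 : ℝ) 1,
    ENNReal.ofReal ((Fhat (observe ω) u - cdf (μ : Measure ℝ) u) ^ 2) ∂volume ∂(fullLaw n μ ν)

/-- The minimax risk: the infimum, over all (jointly measurable) estimators based on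
`(Tᵢ, δᵢ)`, `i = 1, …, n`, of the maximal risk over the class, when `T ∼ ν`. -/
def minimaxRisk (n : ℕ) (β L : ℝ) (ν : ProbabilityMeasure ℝ) : ℝ≥0∞ :=
  ⨅ (Fhat : (Fin n → ℝ × Bool) → ℝ → ℝ) (_ : Measurable (Function.uncurry Fhat)),
    ⨆ μ ∈ lawClass β L, risk n μ ν Fhat

end

end CurrentStatus

namespace CurrentStatus

/-! ### Finite differences -/

/-! The proof is Assouad's method on a hypercube of c.d.f.s. For `w` in `{0,1}^m`, let `F_w(x) = ε x
+ γ ∑ w_k φ(2 m x - m - k)` on `[0,1]`, with `φ` a smooth bump supported in `(0,1)` and `γ = c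
(2m)^(-β)`, so that the `k`-th bump lives on the `k`-th cell of `[1/2,1)`. The line `ε x` keeps
`F_w` increasing and at least `ε/2` on the cells, and costs nothing in the Besov seminorm because
differences of order at least 2 annihilate it (`exists_hypercube_of_laws`).

Given `T = t`, `δ` is Bernoulli with parameter `F(t)`. Flipping `w_k` therefore lowers the Hellinger
affinity of one observation by at most `(γ²/ε) ν(cell k)`, and that of the sample by at most `n`
times as much (`one_le_affinity_add`). A large affinity makes the two hypotheses hard to tell apart
on the cell (`ofReal_mul_affinity_le`).

The cells are disjoint, so their `ν`-masses sum to at most 1 whatever `ν` is. Averaging over `k` as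
well as over `w` (`mul_div_eight_le_of_flip`) thus replaces any assumption on the density of `T`: it
suffices that `n γ²/ε ≤ m/4`. The maximal risk is then at least `γ²/64`, and `m` of order
`n^(1/(2β+1))` gives the rate (`exists_resolution`). -/

lemma abs_fwdDiff_iter_le_of_hasDerivAt (r : ℕ) (G : ℕ → ℝ → ℝ)
    (hG : ∀ j x, HasDerivAt (G j) (G (j + 1) x) x) {B : ℝ} (hB : ∀ x, |G r x| ≤ B) (h x : ℝ) :
    |(fwdDiff h)^[r] (G 0) x| ≤ |h| ^ r * B := by
  induction r generalizing G B with
  | zero => simpa using hB x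
  | succ r ih =>
    -- `G` is a tower of successive derivatives. Differencing it termwise gives another such tower,
    -- whose `r`-th term the mean value inequality bounds by `|h| * B`.
    have key := ih (fun j => fwdDiff h (G j)) (B := |h| * B)
      (fun j x => by
        have h1 : HasDerivAt (fun y => G j (y + h)) (G (j + 1) (x + h)) x :=
          (hG j (x + h)).comp_add_const x h
        exact h1.sub (hG j x))
      (fun x => by
        have := Convex.norm_image_sub_le_of_norm_hasDerivWithin_le
          (f := G r) (f' := G (r + 1)) (s := Set.univ) (C := B) (x := x) (y := x + h)
          (fun y _ => (hG r y).hasDerivWithinAt) (fun y _ => hB y) convex_univ trivial trivial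
        simpa [fwdDiff, mul_comm] using this)
    rw [Function.iterate_succ_apply]
    calc _ ≤ |h| ^ r * (|h| * B) := key
      _ = |h| ^ (r + 1) * B := by ring

lemma abs_fwdDiff_iter_le_two_pow_mul (r : ℕ) {f : ℝ → ℝ} {B : ℝ} (hB : ∀ x, |f x| ≤ B)
    (h x : ℝ) : |(fwdDiff h)^[r] f x| ≤ 2 ^ r * B := by
  induction r generalizing f B with
  | zero => simpa using hB x
  | succ r ih =>
    rw [Function.iterate_succ_apply]
    calc _ ≤ 2 ^ r * (2 * B) := ih fun y => by
            have := abs_sub (f (y + h)) (f y)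
            simp only [fwdDiff]
            linarith [hB y, hB (y + h)]
      _ = 2 ^ (r + 1) * B := by ring

lemma fwdDiff_iter_eq_of_eqOn_Icc (r : ℕ) {f g : ℝ → ℝ} {a b : ℝ}
    (hfg : Set.EqOn f g (Set.Icc a b)) {h x : ℝ} (hx : x ∈ diffDomain r h (Set.Icc a b)) :
    (fwdDiff h)^[r] f x = (fwdDiff h)^[r] g x := by
  rw [fwdDiff_iter_eq_sum_shift, fwdDiff_iter_eq_sum_shift]
  refine Finset.sum_congr rfl fun k hk => ?_
  have hk' : (k : ℝ) ≤ r := by exact_mod_cast Nat.lt_succ_iff.1 (Finset.mem_range.1 hk)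
  have hk0 : (0 : ℝ) ≤ k := Nat.cast_nonneg k
  obtain ⟨⟨h1, h2⟩, h3, h4⟩ := hx
  rw [hfg]
  rw [nsmul_eq_mul]
  -- For either sign of `h`, the point `x + k h` lies between `x` and `x + r h`.
  rcases le_total 0 h with hh | hh <;> constructor <;>
    nlinarith [mul_nonneg hk0 (abs_nonneg h)]

lemma fwdDiff_iter_mul_left_eq_zero {r : ℕ} (hr : 2 ≤ r) (ε h : ℝ) :
    (fwdDiff h)^[r] (fun x => ε * x) = 0 := by
  obtain ⟨s, rfl⟩ := Nat.exists_eq_add_of_le' hr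
  have h2 : (fwdDiff h)^[2] (fun x => ε * x) = 0 := by
    ext x
    simp [fwdDiff]
    ring
  rw [Function.iterate_add_apply, h2]
  induction s with
  | zero => rfl
  | succ s ih =>
    rw [Function.iterate_succ_apply']
    rw [ih (by omega)]
    ext x
    simp [fwdDiff]

/-! ### A sufficient condition for membership in a Besov ball -/

lemma eLpNorm_two_le_of_bound {f : ℝ → ℝ} {s : Set ℝ} (hs : MeasurableSet s)
    (hs1 : s ⊆ Set.Icc 0 1) {C : ℝ} (hf : ∀ x ∈ s, |f x| ≤ C) :
    eLpNorm f 2 (volume.restrict s) ≤ ENNReal.ofReal C := by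
  refine (eLpNorm_le_of_ae_bound ((ae_restrict_iff' hs).2 (ae_of_all _ hf))).trans ?_
  have hv : volume s ≤ 1 := (measure_mono hs1).trans (by simp)
  rw [Measure.restrict_apply_univ]
  exact mul_le_of_le_one_left bot_le (ENNReal.rpow_le_one hv (by simp))

lemma measurableSet_diffDomain (r : ℕ) (h : ℝ) {A : Set ℝ} (hA : MeasurableSet A) :
    MeasurableSet (diffDomain r h A) :=
  hA.inter ((measurable_id.add_const (r * h)) hA)

/-- Since `β > 1`, the order `⌊β⌋ + 1` is at least 2 and the linear part disappears from the
differences. As `[0,1]` has length 1, uniform bounds serve as `L²` bounds. Agreement on `[0,1]`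
alone is enough, so the c.d.f. may be truncated outside. -/
lemma mem_besovBall_of_eqOn {β L ε C : ℝ} (hβ : 1 < β) (hC : 0 ≤ C) (hε : 0 ≤ ε)
    (hL : C + ε ≤ L) {f g : ℝ → ℝ} (hf : Measurable f)
    (hfg : ∀ x ∈ Set.Icc (0 : ℝ) 1, f x = ε * x + g x) (hfε : ∀ x ∈ Set.Icc (0 : ℝ) 1, |f x| ≤ ε)
    (hg : ∀ h x, |(fwdDiff h)^[⌊β⌋₊ + 1] g x| ≤ C * |h| ^ β) :
    f ∈ besovBall β (Set.Icc 0 1) L := by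
  have hnorm : eLpNorm f 2 (volume.restrict (Set.Icc 0 1)) ≤ ENNReal.ofReal ε :=
    eLpNorm_two_le_of_bound measurableSet_Icc subset_rfl hfε
  refine ⟨⟨hf.aestronglyMeasurable, hnorm.trans_lt ENNReal.ofReal_lt_top⟩, ?_⟩
  have hsemi : besovSeminorm β (Set.Icc 0 1) f ≤ ENNReal.ofReal C := by
    refine iSup₂_le fun t ht => ?_
    have hmod : modulus (⌊β⌋₊ + 1) f t (Set.Icc 0 1) ≤ ENNReal.ofReal (C * t ^ β) := by
      refine iSup₂_le fun h hh => ?_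
      refine eLpNorm_two_le_of_bound (measurableSet_diffDomain _ _ measurableSet_Icc)
        (fun x hx => hx.1) fun x hx => ?_
      have hr : 2 ≤ ⌊β⌋₊ + 1 := by
        have : 1 ≤ ⌊β⌋₊ := Nat.le_floor (by simpa using hβ.le)
        omega
      have e1 : (fwdDiff h)^[⌊β⌋₊ + 1] f x = (fwdDiff h)^[⌊β⌋₊ + 1] g x := by
        rw [fwdDiff_iter_eq_of_eqOn_Icc _ (g := (fun x => ε * x) + g) hfg hx, fwdDiff_iter_add,
          fwdDiff_iter_mul_left_eq_zero hr]
        simp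
      rw [e1]
      refine (hg h x).trans ?_
      gcongr
    calc _ ≤ ENNReal.ofReal (t ^ (-β)) * ENNReal.ofReal (C * t ^ β) := by gcongr
      _ = ENNReal.ofReal C := by
        rw [← ENNReal.ofReal_mul (by positivity), Real.rpow_neg ht.le]
        congr 1
        have : t ^ β ≠ 0 := (Real.rpow_pos_of_pos ht β).ne'
        field_simp
  calc besovNorm β (Set.Icc 0 1) f ≤ ENNReal.ofReal C + ENNReal.ofReal ε := add_le_add hsemi hnorm
    _ = ENNReal.ofReal (C + ε) := (ENNReal.ofReal_add hC hε).symm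
    _ ≤ ENNReal.ofReal L := ENNReal.ofReal_le_ofReal hL

/-! ### Bumps -/

lemma exists_smooth_bump : ∃ φ : ℕ → ℝ → ℝ, (∀ j x, HasDerivAt (φ j) (φ (j + 1) x) x) ∧
    (∀ j, ∃ M, ∀ x, |φ j x| ≤ M) ∧ (∀ j x, φ j x ≠ 0 → 0 < x ∧ x < 1) ∧
    (∀ x, 0 ≤ φ 0 x ∧ φ 0 x ≤ 1) ∧ ∀ x ∈ Set.Icc (3 / 8 : ℝ) (5 / 8), φ 0 x = 1 := by
  let b : ContDiffBump (1 / 2 : ℝ) := ⟨1 / 8, 1 / 4, by norm_num, by norm_num⟩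
  have hb : ContDiff ℝ ((⊤ : ℕ∞) : WithTop ℕ∞) (b : ℝ → ℝ) := b.contDiff
  have hder : ∀ j x, HasDerivAt (iteratedDeriv j b) (iteratedDeriv (j + 1) b x) x := by
    intro j x
    rw [iteratedDeriv_succ]
    exact ((hb.differentiable_iteratedDeriv j (by exact_mod_cast WithTop.coe_lt_top _)) x).hasDerivAt
  have hsupp : ∀ j x, x < 1 / 4 ∨ 3 / 4 < x → iteratedDeriv j b x = 0 := by
    intro j
    induction j with
    | zero =>
      intro x hx
      rw [iteratedDeriv_zero]
      refine b.zero_of_le_dist ?_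
      rw [Real.dist_eq]
      change 1 / 4 ≤ _
      rcases hx with hx | hx
      · rw [abs_of_nonpos (by linarith)]; linarith
      · rw [abs_of_nonneg (by linarith)]; linarith
    | succ j ih =>
      intro x hx
      have hopen : {y : ℝ | y < 1 / 4 ∨ 3 / 4 < y} ∈ nhds x :=
        ((isOpen_Iio (a := (1 / 4 : ℝ))).union (isOpen_Ioi (a := (3 / 4 : ℝ)))).mem_nhds hx
      have h0 : HasDerivAt (iteratedDeriv j b) 0 x :=
        (hasDerivAt_const x (0 : ℝ)).congr_of_eventuallyEq (by
          filter_upwards [hopen] with y hy using ih y hy)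
      exact (hder j x).unique h0
  refine ⟨fun j => iteratedDeriv j b, hder, fun j => ?_, fun j x hx => ?_, fun x => ?_,
    fun x hx => ?_⟩
  · obtain ⟨M, hM⟩ := isCompact_Icc.exists_bound_of_continuousOn (s := Set.Icc (1 / 4 : ℝ) (3 / 4))
      (f := iteratedDeriv j b) (fun x _ => (hder j x).continuousAt.continuousWithinAt)
    refine ⟨max M 0, fun x => ?_⟩
    by_cases hx : x ∈ Set.Icc (1 / 4 : ℝ) (3 / 4)
    · exact (hM x hx).trans (le_max_left _ _)
    · have : x < 1 / 4 ∨ 3 / 4 < x := by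
        by_contra! hc
        exact hx ⟨hc.1, hc.2⟩
      simp [hsupp j x this]
  · by_contra hc
    refine hx (hsupp j x ?_)
    by_contra! hc'
    exact hc ⟨by linarith, by linarith⟩
  · simpa using ⟨b.nonneg, b.le_one⟩
  · simp only [iteratedDeriv_zero]
    refine b.one_of_mem_closedBall ?_
    rw [Metric.mem_closedBall, Real.dist_eq, abs_le]
    change -(1 / 8) ≤ _ ∧ _ ≤ 1 / 8
    constructor <;> linarith [hx.1, hx.2]

/-- The sum of the integer translates of `ψ` selected by `w`. -/
def bumpSum {m : ℕ} (w : Fin m → Bool) (ψ : ℝ → ℝ) (y : ℝ) : ℝ :=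
  ∑ k, if w k then ψ (y - (k : ℕ)) else 0

section bumpSum

variable {m : ℕ} {ψ : ℝ → ℝ}

lemma hasDerivAt_bumpSum (w : Fin m → Bool) {ψ' : ℝ → ℝ} (h : ∀ x, HasDerivAt ψ (ψ' x) x) (y : ℝ) :
    HasDerivAt (bumpSum w ψ) (bumpSum w ψ' y) y := by
  unfold bumpSum
  refine HasDerivAt.fun_sum fun k _ => ?_
  by_cases hw : w k
  · simpa [hw] using (h (y - (k : ℕ))).comp_sub_const y _
  · simpa [hw] using hasDerivAt_const y (0 : ℝ)

lemma bumpSum_eq_of_mem_Ico (w : Fin m → Bool) (hψ : ∀ x, ψ x ≠ 0 → 0 < x ∧ x < 1) (k : Fin m)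
    {y : ℝ} (hy : y ∈ Set.Ico ((k : ℕ) : ℝ) ((k : ℕ) + 1)) :
    bumpSum w ψ y = if w k then ψ (y - (k : ℕ)) else 0 := by
  unfold bumpSum
  refine Finset.sum_eq_single k (fun j _ hj => ?_) (by simp)
  have h0 : ψ (y - (j : ℕ)) = 0 := by
    by_contra hc
    obtain ⟨h1, h2⟩ := hψ _ hc
    have a1 : ((k : ℕ) : ℝ) < (j : ℕ) + 1 := by linarith [hy.1]
    have a2 : ((j : ℕ) : ℝ) < (k : ℕ) + 1 := by linarith [hy.2]
    norm_cast at a1 a2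
    exact hj (Fin.ext (by omega))
  simp [h0]

lemma bumpSum_eq_zero_of_not_mem_Ico (w : Fin m → Bool) (hψ : ∀ x, ψ x ≠ 0 → 0 < x ∧ x < 1)
    {y : ℝ} (hy : ∀ k : Fin m, y ∉ Set.Ico ((k : ℕ) : ℝ) ((k : ℕ) + 1)) : bumpSum w ψ y = 0 := by
  unfold bumpSum
  refine Finset.sum_eq_zero fun k _ => ?_
  have h0 : ψ (y - (k : ℕ)) = 0 := by
    by_contra hc
    obtain ⟨h1, h2⟩ := hψ _ hc
    exact hy k ⟨by linarith, by linarith⟩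
  simp [h0]

/-- The translates have disjoint supports, so the sum takes only the value 0 and values of `ψ`.
Bounds on `ψ` thus pass to the sum without growing with `m`. -/
lemma bumpSum_mem_of_forall (w : Fin m → Bool) (hψ : ∀ x, ψ x ≠ 0 → 0 < x ∧ x < 1) {s : Set ℝ}
    (h0 : 0 ∈ s) (hs : ∀ x, ψ x ∈ s) (y : ℝ) : bumpSum w ψ y ∈ s := by
  by_cases hy : ∃ k : Fin m, y ∈ Set.Ico ((k : ℕ) : ℝ) ((k : ℕ) + 1)
  · obtain ⟨k, hk⟩ := hy
    rw [bumpSum_eq_of_mem_Ico w hψ k hk]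
    split_ifs
    exacts [hs _, h0]
  · rw [bumpSum_eq_zero_of_not_mem_Ico w hψ (not_exists.1 hy)]
    exact h0

lemma bumpSum_congr_of_not_mem_Ico {w w' : Fin m → Bool} (hψ : ∀ x, ψ x ≠ 0 → 0 < x ∧ x < 1)
    {k : Fin m} (hw : ∀ j, j ≠ k → w' j = w j) {y : ℝ}
    (hy : y ∉ Set.Ico ((k : ℕ) : ℝ) ((k : ℕ) + 1)) : bumpSum w' ψ y = bumpSum w ψ y := by
  unfold bumpSum
  refine Finset.sum_congr rfl fun j _ => ?_
  by_cases hj : j = k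
  · subst hj
    have h0 : ψ (y - (j : ℕ)) = 0 := by
      by_contra hc
      obtain ⟨h1, h2⟩ := hψ _ hc
      exact hy ⟨by linarith, by linarith⟩
    simp [h0]
  · rw [hw j hj]

end bumpSum

/-! ### Laws with prescribed c.d.f. -/

lemma exists_law_cdf_eq {ε : ℝ} (hε : 0 < ε) (hε1 : ε ≤ 1) {g : ℝ → ℝ} (hgc : Continuous g)
    (hmono : Monotone fun x => ε * x + g x) (hg0 : ∀ x ≤ 0, g x = 0) (hg1 : ∀ x, 1 ≤ x → g x = 0) :
    ∃ μ : ProbabilityMeasure ℝ, (∀ᵐ y ∂(μ : Measure ℝ), 0 < y) ∧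
      -- Beyond 1 the c.d.f. follows the line `ε x` until it reaches height 1 at `x = 1 / ε`.
      ∀ x, cdf (μ : Measure ℝ) x = max 0 (min 1 (ε * x + g x)) := by
  have hcont : Continuous fun x => max 0 (min 1 (ε * x + g x)) := by fun_prop
  let F : StieltjesFunction ℝ :=
    { toFun := fun x => max 0 (min 1 (ε * x + g x))
      mono' := fun x y hxy => max_le_max le_rfl (min_le_min le_rfl (hmono hxy))
      right_continuous' := fun x => hcont.continuousWithinAt }
  have hF : ∀ x, F x = max 0 (min 1 (ε * x + g x)) := fun x => rfl
  have hFneg : ∀ x ≤ 0, F x = 0 := fun x hx => by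
    rw [hF, hg0 x hx, max_eq_left]
    exact (min_le_right _ _).trans (by nlinarith)
  have hFone : ∀ x, 1 / ε ≤ x → F x = 1 := fun x hx => by
    have h1 : 1 ≤ ε * x := by rwa [div_le_iff₀' hε] at hx
    have h2 : 1 ≤ x := le_trans (by rw [le_div_iff₀ hε]; linarith) hx
    rw [hF, hg1 x h2, min_eq_left (by linarith), max_eq_right zero_le_one]
  have hbot : Filter.Tendsto F Filter.atBot (nhds 0) :=
    tendsto_const_nhds.congr' (by
      filter_upwards [Filter.eventually_le_atBot (0 : ℝ)] with x hx using (hFneg x hx).symm)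
  have htop : Filter.Tendsto F Filter.atTop (nhds 1) :=
    tendsto_const_nhds.congr' (by
      filter_upwards [Filter.eventually_ge_atTop (1 / ε)] with x hx using (hFone x hx).symm)
  refine ⟨⟨F.measure, F.isProbabilityMeasure hbot htop⟩, ?_, fun x => ?_⟩
  · rw [ae_iff]
    have : {a : ℝ | ¬0 < a} = Set.Iic 0 := by ext; simp
    change F.measure _ = 0
    rw [this, F.measure_Iic hbot, hFneg 0 le_rfl]
    simp
  · change cdf F.measure x = _
    rw [cdf_measure_stieltjesFunction F hbot htop, hF]

/-! ### Cells of `[1/2, 1)` and the hypercube of laws. -/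

/-- The `k`-th of the `m` cells of length `1 / (2 * m)` that partition `[1/2, 1)`. -/
def cell (m k : ℕ) : Set ℝ := {t | 2 * m * t - m ∈ Set.Ico (k : ℝ) (k + 1)}

/-- The middle quarter of `cell m k`. -/
def cellCore (m k : ℕ) : Set ℝ := {t | 2 * m * t - m - k ∈ Set.Icc (3 / 8 : ℝ) (5 / 8)}

lemma measurableSet_cell (m k : ℕ) : MeasurableSet (cell m k) :=
  (by fun_prop : Measurable fun t : ℝ => 2 * m * t - m) measurableSet_Ico

lemma measurableSet_cellCore (m k : ℕ) : MeasurableSet (cellCore m k) :=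
  (by fun_prop : Measurable fun t : ℝ => 2 * m * t - m - k) measurableSet_Icc

lemma cellCore_subset_cell (m k : ℕ) : cellCore m k ⊆ cell m k :=
  fun _ ht => ⟨by linarith [ht.1], by linarith [ht.2]⟩

lemma cell_subset_Icc {m k : ℕ} (hk : k < m) : cell m k ⊆ Set.Icc (1 / 2) 1 := by
  intro t ht
  have hm : (0 : ℝ) < m := by exact_mod_cast (Nat.zero_le k).trans_lt hk
  have hk1 : (k : ℝ) + 1 ≤ m := by exact_mod_cast hk
  have hk0 : (0 : ℝ) ≤ k := Nat.cast_nonneg k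
  constructor <;> nlinarith [ht.1, ht.2]

lemma disjoint_cell {m j k : ℕ} (hjk : j ≠ k) : Disjoint (cell m j) (cell m k) := by
  rw [Set.disjoint_left]
  rintro t ⟨h1, h2⟩ ⟨h3, h4⟩
  have a1 : (j : ℝ) < k + 1 := by linarith
  have a2 : (k : ℝ) < j + 1 := by linarith
  norm_cast at a1 a2
  omega

lemma volume_cellCore {m : ℕ} (hm : 0 < m) (k : ℕ) :
    volume (cellCore m k) = ENNReal.ofReal (1 / (8 * m)) := by
  have hm' : (0 : ℝ) < m := by exact_mod_cast hm
  have : cellCore m k = Set.Icc ((m + k + 3 / 8) / (2 * m) : ℝ) ((m + k + 5 / 8) / (2 * m)) := by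
    ext t
    simp only [cellCore, Set.mem_ofPred_eq, Set.mem_Icc]
    rw [div_le_iff₀ (c := (2 * m : ℝ)) (by positivity),
      le_div_iff₀ (c := (2 * m : ℝ)) (by positivity)]
    constructor <;> rintro ⟨h1, h2⟩ <;> constructor <;> linarith
  rw [this, Real.volume_Icc]
  congr 1
  field_simp
  ring

lemma exists_hypercube_of_laws {β L : ℝ} (hβ : 1 < β) (hL : 0 < L) :
    ∃ ε c : ℝ, 0 < ε ∧ 0 < c ∧ c ^ 2 / ε ≤ 1 / 4 ∧ ∀ m : ℕ, 0 < m →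
      ∃ μ : (Fin m → Bool) → ProbabilityMeasure ℝ, (∀ w, μ w ∈ lawClass β L) ∧
        (∀ (w w' : Fin m → Bool) (k : Fin m), (∀ j, j ≠ k → w' j = w j) → ∀ t, t ∉ cell m k →
          cdf (μ w' : Measure ℝ) t = cdf (μ w : Measure ℝ) t) ∧
        (∀ (w : Fin m → Bool) (k : Fin m), ∀ t ∈ cell m k,
          ε / 2 ≤ cdf (μ w : Measure ℝ) t ∧ cdf (μ w : Measure ℝ) t ≤ 1 / 2) ∧
        (∀ (w w' : Fin m → Bool) (k : Fin m), ∀ t ∈ cell m k,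
          (cdf (μ w : Measure ℝ) t - cdf (μ w' : Measure ℝ) t) ^ 2 ≤ (c * (2 * m) ^ (-β)) ^ 2) ∧
        (∀ (w w' : Fin m → Bool) (k : Fin m), w k ≠ w' k → ∀ t ∈ cellCore m k,
          (cdf (μ w : Measure ℝ) t - cdf (μ w' : Measure ℝ) t) ^ 2 = (c * (2 * m) ^ (-β)) ^ 2) := by
  obtain ⟨φ, hder, hbd, hsupp, h01, hone⟩ := exists_smooth_bump
  choose M hM using hbd
  have hM0 : ∀ j, 0 ≤ M j := fun j => (abs_nonneg _).trans (hM j 0)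
  set r := ⌊β⌋₊ + 1 with hr
  have hrβ : β ≤ r := by
    rw [hr]; push_cast; exact (Nat.lt_floor_add_one β).le
  set ε := min (1 / 2) (L / 2) with hεdef
  have hε : 0 < ε := by positivity
  have hε2 : ε ≤ 1 / 2 := min_le_left _ _
  have hεL : ε ≤ L / 2 := min_le_right _ _
  -- Each summand of `D` serves one bound on `c = ε / D`: `4` gives `c ^ 2 / ε ≤ 1 / 4`, `M 1`
  -- monotonicity, `M r` the differences with small step, and `2 ^ r` those with large step.
  set D := 4 + M 1 + M r + 2 ^ r with hD
  have hDpos : 0 < D := by have := hM0 1; have := hM0 r; positivity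
  have hD4 : 4 ≤ D := by have := hM0 1; have := hM0 r; have : (0 : ℝ) ≤ 2 ^ r := by positivity
                         linarith
  have hD1 : M 1 ≤ D := by have := hM0 r; have : (0 : ℝ) ≤ 2 ^ r := by positivity
                           linarith
  have hDr : M r ≤ D := by have := hM0 1; have : (0 : ℝ) ≤ 2 ^ r := by positivity
                           linarith
  have hD2 : 2 ^ r ≤ D := by linarith [hM0 1, hM0 r]
  set c := ε / D with hc
  have hcpos : 0 < c := by positivity
  have hcD : c * D = ε := by rw [hc]; field_simp
  have hc4 : c ≤ ε / 4 := by rw [hc]; gcongr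
  refine ⟨ε, c, hε, hcpos, ?_, fun m hm => ?_⟩
  · rw [div_le_iff₀ hε]; nlinarith
  have hm1 : (1 : ℝ) ≤ m := by exact_mod_cast hm
  set N : ℝ := 2 * m with hN
  have hN1 : 1 ≤ N := by linarith
  have hN0 : 0 < N := by linarith
  set γ := c * N ^ (-β) with hγ
  have hNβ : 0 < N ^ (-β) := Real.rpow_pos_of_pos hN0 _
  have hγ0 : 0 < γ := by positivity
  let G : (Fin m → Bool) → ℕ → ℝ → ℝ := fun w j x => γ * N ^ j * bumpSum w (φ j) (N * x - m)
  have hG0 : ∀ w x, G w 0 x = γ * bumpSum w (φ 0) (N * x - m) := fun w x => by simp [G]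
  have hGder : ∀ w j x, HasDerivAt (G w j) (G w (j + 1) x) x := fun w j x => by
    have h1 : HasDerivAt (fun x => N * x - m) N x := by
      simpa using ((hasDerivAt_id x).const_mul N).sub_const (m : ℝ)
    have h2 := ((hasDerivAt_bumpSum w (hder j) (N * x - m)).comp x h1).const_mul (γ * N ^ j)
    exact h2.congr_deriv (by simp only [G]; ring)
  have hSbd : ∀ (w : Fin m → Bool) j y, |bumpSum w (φ j) y| ≤ M j := fun w j y => by
    have := bumpSum_mem_of_forall w (hsupp j) (s := Set.Icc (-M j) (M j))
      ⟨by linarith [hM0 j], hM0 j⟩ (fun x => abs_le.1 (hM j x)) y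
    exact abs_le.2 this
  have hS01 : ∀ (w : Fin m → Bool) y, bumpSum w (φ 0) y ∈ Set.Icc (0 : ℝ) 1 := fun w y =>
    bumpSum_mem_of_forall w (hsupp 0) (by simp) h01 y
  have hGbd : ∀ w j x, |G w j x| ≤ γ * N ^ j * M j := fun w j x => by
    simp only [G]
    rw [abs_mul, abs_of_pos (by positivity)]
    exact mul_le_mul_of_nonneg_left (hSbd w j _) (by positivity)
  have hGzero : ∀ (w : Fin m → Bool) x, (x ≤ 1 / 2 ∨ 1 ≤ x) → G w 0 x = 0 := fun w x hx => by
    have : bumpSum w (φ 0) (N * x - m) = 0 := by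
      unfold bumpSum
      refine Finset.sum_eq_zero fun k _ => ?_
      have hk : ((k : ℕ) : ℝ) + 1 ≤ m := by exact_mod_cast k.2
      have hk0 : (0 : ℝ) ≤ ((k : ℕ) : ℝ) := Nat.cast_nonneg _
      have : φ 0 (N * x - m - (k : ℕ)) = 0 := by
        by_contra hcon
        obtain ⟨h1, h2⟩ := hsupp 0 _ hcon
        rcases hx with hx | hx <;> nlinarith
      simp [this]
    rw [hG0, this, mul_zero]
  -- The bumps have slope of order `N ^ (1 - β)`, at most 1 since `β > 1`, so the slope `ε` of the
  -- line dominates them.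
  have hslope : γ * N ^ 1 * M 1 ≤ ε := by
    have h1 : N ^ (-β) * N ≤ 1 := by
      rw [← Real.rpow_add_one hN0.ne']
      exact Real.rpow_le_one_of_one_le_of_nonpos hN1 (by linarith)
    calc γ * N ^ 1 * M 1 = (N ^ (-β) * N) * (c * M 1) := by rw [hγ]; ring
      _ ≤ 1 * (c * D) := by have := hM0 1; gcongr
      _ = ε := by rw [hcD, one_mul]
  have hmono : ∀ w, Monotone fun x => ε * x + G w 0 x := fun w => by
    have hd : ∀ x, HasDerivAt (fun x => ε * x + G w 0 x) (ε + G w 1 x) x := fun x => by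
      simpa using ((hasDerivAt_id x).const_mul ε).fun_add (hGder w 0 x)
    refine monotone_of_deriv_nonneg (fun x => (hd x).differentiableAt) fun x => ?_
    rw [(hd x).deriv]
    linarith [(abs_le.1 ((hGbd w 1 x).trans hslope)).1]
  choose μ hμpos hμ using fun w => exists_law_cdf_eq hε (by linarith)
    (continuous_iff_continuousAt.2 fun x => (hGder w 0 x).continuousAt) (hmono w)
    (fun x hx => hGzero w x (Or.inl (by linarith))) (fun x hx => hGzero w x (Or.inr hx))
  -- The bumps vanish at 0 and 1, so monotonicity confines the function to `[0, ε]` and the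
  -- truncation at 0 and 1 is inactive on `[0,1]`.
  have hrange : ∀ w, ∀ x ∈ Set.Icc (0 : ℝ) 1, 0 ≤ ε * x + G w 0 x ∧ ε * x + G w 0 x ≤ ε :=
    fun w x hx => by
      have h0 := hmono w hx.1
      have h1 := hmono w hx.2
      simp only [hGzero w 0 (by norm_num), hGzero w 1 (by norm_num)] at h0 h1
      constructor <;> linarith
  have hcdf : ∀ w, ∀ x ∈ Set.Icc (0 : ℝ) 1, cdf (μ w : Measure ℝ) x = ε * x + G w 0 x :=
    fun w x hx => by
      obtain ⟨h1, h2⟩ := hrange w x hx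
      rw [hμ, min_eq_right (by linarith), max_eq_right h1]
  have hcell : ∀ k : Fin m, ∀ t ∈ cell m k, t ∈ Set.Icc (1 / 2 : ℝ) 1 ∧ t ∈ Set.Icc (0 : ℝ) 1 :=
    fun k t ht => by
      have := cell_subset_Icc k.2 ht
      exact ⟨this, by linarith [this.1], this.2⟩
  have hGnn : ∀ w x, 0 ≤ G w 0 x ∧ G w 0 x ≤ γ := fun w x => by
    rw [hG0]
    have := hS01 w (N * x - m)
    exact ⟨mul_nonneg hγ0.le this.1, mul_le_of_le_one_right hγ0.le this.2⟩
  refine ⟨μ, fun w => ⟨hμpos w, ?_⟩, ?_, ?_, ?_, ?_⟩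
  · refine mem_besovBall_of_eqOn (C := ε) (g := G w 0) hβ hε.le hε.le (by linarith)
      (monotone_cdf _).measurable (hcdf w) (fun x hx => ?_) fun h x => ?_
    · rw [hcdf w x hx, abs_of_nonneg (hrange w x hx).1]
      exact (hrange w x hx).2
    · have hscale : N ^ (-β) * (N * |h|) ^ β = |h| ^ β := by
        rw [Real.mul_rpow hN0.le (abs_nonneg h), ← mul_assoc, ← Real.rpow_add hN0]
        simp
      have hh0 : 0 ≤ N * |h| := by positivity
      -- Steps shorter than the bump scale `1 / N` use the `r`-th derivative and `β ≤ r`; longer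
      -- steps use only the height `γ` of the bumps.
      rcases le_total (N * |h|) 1 with hh | hh
      · have hp : (N * |h|) ^ r ≤ (N * |h|) ^ β := by
          rw [← Real.rpow_natCast]
          exact Real.rpow_le_rpow_of_exponent_ge_of_imp hh0 hh hrβ (fun _ h0 => by linarith)
        calc _ ≤ |h| ^ r * (γ * N ^ r * M r) :=
              abs_fwdDiff_iter_le_of_hasDerivAt r (G w) (hGder w) (hGbd w r) h x
          _ = (c * M r) * (N ^ (-β) * (N * |h|) ^ r) := by rw [hγ, mul_pow]; ring
          _ ≤ (c * D) * (N ^ (-β) * (N * |h|) ^ β) := by have := hM0 r; gcongr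
          _ = ε * |h| ^ β := by rw [hcD, hscale]
      · have hp : 1 ≤ (N * |h|) ^ β := Real.one_le_rpow hh (by linarith)
        calc _ ≤ 2 ^ r * γ := abs_fwdDiff_iter_le_two_pow_mul r
              (fun x => by rw [abs_of_nonneg (hGnn w x).1]; exact (hGnn w x).2) h x
          _ = (c * 2 ^ r) * (N ^ (-β) * 1) := by rw [hγ]; ring
          _ ≤ (c * D) * (N ^ (-β) * (N * |h|) ^ β) := by gcongr
          _ = ε * |h| ^ β := by rw [hcD, hscale]
  · intro w w' k hw t ht
    rw [hμ, hμ, hG0, hG0, bumpSum_congr_of_not_mem_Ico (hsupp 0) hw ht]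
  · intro w k t ht
    obtain ⟨h1, h2⟩ := hcell k t ht
    rw [hcdf w t h2]
    exact ⟨by nlinarith [h1.1, (hGnn w t).1], by linarith [(hrange w t h2).2]⟩
  · intro w w' k t ht
    obtain ⟨h1, h2⟩ := hcell k t ht
    rw [hcdf w t h2, hcdf w' t h2, sq_le_sq, abs_of_pos hγ0, abs_le]
    constructor <;> linarith [hGnn w t, hGnn w' t]
  · intro w w' k hw t ht
    have ht' := cellCore_subset_cell m k ht
    obtain ⟨h1, h2⟩ := hcell k t ht'
    rw [hcdf w t h2, hcdf w' t h2, hG0, hG0, bumpSum_eq_of_mem_Ico w (hsupp 0) k ht',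
      bumpSum_eq_of_mem_Ico w' (hsupp 0) k ht', hone _ ht]
    cases hk : w k <;> cases hk' : w' k <;> rw [hk, hk'] at hw <;>
      first | exact absurd rfl hw | (simp only [if_true, Bool.false_eq_true, if_false]; ring)

/-! ### Products of densities -/

lemma lintegral_pi_prod_eq_prod {α : Type*} [MeasurableSpace α] (ρ : Measure α) [SigmaFinite ρ]
    (n : ℕ) {f : Fin n → α → ℝ≥0∞} (hf : ∀ i, Measurable (f i)) :
    ∫⁻ x, ∏ i, f i (x i) ∂(Measure.pi fun _ : Fin n => ρ) = ∏ i, ∫⁻ a, f i a ∂ρ := by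
  induction n with
  | zero => simp
  | succ n ih =>
    have hmp := (measurePreserving_piFinSuccAbove (fun _ : Fin (n + 1) => ρ) 0).symm
    rw [← hmp.lintegral_comp_emb (MeasurableEquiv.measurableEmbedding _)]
    have hsplit : ∀ z : α × (Fin n → α), ∏ i, f i
        ((MeasurableEquiv.piFinSuccAbove (fun _ : Fin (n + 1) => α) 0).symm z i) =
          f 0 z.1 * ∏ i : Fin n, f i.succ (z.2 i) := fun z => by
      rw [Fin.prod_univ_succ]
      rfl
    simp only [hsplit]
    rw [Fin.prod_univ_succ]
    rw [lintegral_prod_mul (f := f 0)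
      (g := fun y : Fin n → α => ∏ i : Fin n, f i.succ (y i)) (hf 0).aemeasurable
      (Finset.measurable_prod _ fun i _ => (hf _).comp (measurable_pi_apply i)).aemeasurable,
      ih fun i => hf i.succ]

lemma pi_withDensity_eq {α : Type*} [MeasurableSpace α] (ρ : Measure α) [SigmaFinite ρ]
    (n : ℕ) {f : α → ℝ≥0∞} (hf : Measurable f) [SigmaFinite (ρ.withDensity f)] :
    Measure.pi (fun _ : Fin n => ρ.withDensity f) =
      (Measure.pi fun _ : Fin n => ρ).withDensity fun x => ∏ i, f (x i) := by
  refine (Measure.pi_eq fun s hs => ?_)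
  rw [withDensity_apply _ (MeasurableSet.univ_pi hs),
    ← lintegral_indicator (MeasurableSet.univ_pi hs)]
  have : ∀ x : Fin n → α, (Set.univ.pi s).indicator (fun x => ∏ i, f (x i)) x =
      ∏ i, (s i).indicator f (x i) := fun x => by
    by_cases hx : x ∈ Set.univ.pi s
    · rw [Set.indicator_of_mem hx]
      exact Finset.prod_congr rfl fun i _ => (Set.indicator_of_mem (hx i trivial) _).symm
    · rw [Set.indicator_of_notMem hx]
      simp only [Set.mem_pi, Set.mem_univ, true_implies, not_forall] at hx
      obtain ⟨i, hi⟩ := hx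
      exact (Finset.prod_eq_zero (Finset.mem_univ i) (Set.indicator_of_notMem hi _)).symm
  simp only [this]
  rw [lintegral_pi_prod_eq_prod ρ n fun i => hf.indicator (hs i)]
  exact Finset.prod_congr rfl fun i _ => by
    rw [lintegral_indicator (hs i), withDensity_apply _ (hs i)]

/-! ### The law of the observations -/

/-- The density of `(T, δ)` with respect to the product of the law of `T` and counting measure. -/
noncomputable def obsDensity (μ : ProbabilityMeasure ℝ) (z : ℝ × Bool) : ℝ :=
  if z.2 then cdf (μ : Measure ℝ) z.1 else 1 - cdf (μ : Measure ℝ) z.1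

lemma obsDensity_nonneg (μ : ProbabilityMeasure ℝ) (z : ℝ × Bool) : 0 ≤ obsDensity μ z := by
  unfold obsDensity
  split_ifs
  · exact cdf_nonneg _ _
  · linarith [cdf_le_one (μ : Measure ℝ) z.1]

lemma measurable_cdf (μ : ProbabilityMeasure ℝ) : Measurable fun u => cdf (μ : Measure ℝ) u :=
  (monotone_cdf _).measurable

lemma measurable_obsDensity (μ : ProbabilityMeasure ℝ) : Measurable (obsDensity μ) := by
  have h := (measurable_cdf μ).comp (measurable_fst : Measurable (Prod.fst : ℝ × Bool → ℝ))
  exact Measurable.ite (measurable_snd (measurableSet_singleton true)) h (measurable_const.sub h)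

lemma lintegral_prod_count_bool (ν : ProbabilityMeasure ℝ) {G : ℝ × Bool → ℝ≥0∞}
    (hG : Measurable G) :
    ∫⁻ z, G z ∂((ν : Measure ℝ).prod Measure.count) =
      ∫⁻ t, (G (t, true) + G (t, false)) ∂(ν : Measure ℝ) := by
  rw [lintegral_prod _ hG.aemeasurable]
  simp [lintegral_count]

lemma measurable_observe_one :
    Measurable fun p : ℝ × ℝ => ((p.2, decide (p.1 ≤ p.2)) : ℝ × Bool) := by
  refine measurable_snd.prodMk (measurable_to_bool ?_)
  have : (fun p : ℝ × ℝ => decide (p.1 ≤ p.2)) ⁻¹' {true} = {p | p.1 ≤ p.2} := by ext; simp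
  rw [this]
  exact measurableSet_le measurable_fst measurable_snd

/-- Integrating over `y` with `T = t` fixed and splitting at `t` gives mass `F t` to `δ = true` and
`1 - F t` to `δ = false`. -/
lemma map_observe_one (μ ν : ProbabilityMeasure ℝ) :
    ((μ : Measure ℝ).prod (ν : Measure ℝ)).map (fun p => ((p.2, decide (p.1 ≤ p.2)) : ℝ × Bool)) =
      ((ν : Measure ℝ).prod Measure.count).withDensity
        fun z => ENNReal.ofReal (obsDensity μ z) := by
  refine Measure.ext_of_lintegral _ fun G hG => ?_
  have hd : Measurable fun z => ENNReal.ofReal (obsDensity μ z) :=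
    (measurable_obsDensity μ).ennreal_ofReal
  rw [lintegral_map hG measurable_observe_one,
    lintegral_prod_symm (fun p : ℝ × ℝ => G (p.2, decide (p.1 ≤ p.2)))
      (hG.comp measurable_observe_one).aemeasurable,
    lintegral_withDensity_eq_lintegral_mul _ hd hG, lintegral_prod_count_bool ν (hd.mul hG)]
  refine lintegral_congr fun t => ?_
  rw [← lintegral_add_compl _ (measurableSet_Iic (a := t))]
  congr 1
  · rw [setLIntegral_congr_fun measurableSet_Iic (g := fun _ => G (t, true))
      (fun y hy => by simp [Set.mem_Iic.1 hy])]
    simp [obsDensity, ofReal_cdf, mul_comm]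
  · rw [setLIntegral_congr_fun measurableSet_Iic.compl (g := fun _ => G (t, false))
      (fun y hy => by simp [show ¬ y ≤ t from hy])]
    have : ENNReal.ofReal (1 - cdf (μ : Measure ℝ) t) = (μ : Measure ℝ) (Set.Iic t)ᶜ := by
      rw [prob_compl_eq_one_sub measurableSet_Iic, ENNReal.ofReal_sub _ (cdf_nonneg _ _),
        ofReal_cdf, ENNReal.ofReal_one]
    simp [obsDensity, this, mul_comm]

/-- The joint density of the observed sample. -/
noncomputable def sampleDensity (n : ℕ) (μ : ProbabilityMeasure ℝ) (z : Fin n → ℝ × Bool) : ℝ :=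
  ∏ i, obsDensity μ (z i)

/-- The measure with respect to which `sampleDensity` is a density. -/
noncomputable def sampleRef (n : ℕ) (ν : ProbabilityMeasure ℝ) : Measure (Fin n → ℝ × Bool) :=
  Measure.pi fun _ => (ν : Measure ℝ).prod Measure.count

lemma sampleDensity_nonneg (n : ℕ) (μ : ProbabilityMeasure ℝ) (z : Fin n → ℝ × Bool) :
    0 ≤ sampleDensity n μ z :=
  Finset.prod_nonneg fun _ _ => obsDensity_nonneg _ _

lemma measurable_sampleDensity (n : ℕ) (μ : ProbabilityMeasure ℝ) :
    Measurable (sampleDensity n μ) :=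
  Finset.measurable_prod _ fun i _ => (measurable_obsDensity μ).comp (measurable_pi_apply i)

lemma measurable_observe {n : ℕ} : Measurable (observe (n := n)) :=
  measurable_pi_lambda _ fun i => measurable_observe_one.comp (measurable_pi_apply i)

lemma map_observe (n : ℕ) (μ ν : ProbabilityMeasure ℝ) :
    (fullLaw n μ ν).map observe =
      (sampleRef n ν).withDensity fun z => ENNReal.ofReal (sampleDensity n μ z) := by
  have hprob : IsProbabilityMeasure (((ν : Measure ℝ).prod Measure.count).withDensity
      fun z => ENNReal.ofReal (obsDensity μ z)) := by
    rw [← map_observe_one]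
    exact Measure.isProbabilityMeasure_map measurable_observe_one.aemeasurable
  have h1 : (fullLaw n μ ν).map observe = Measure.pi fun _ : Fin n =>
      ((μ : Measure ℝ).prod (ν : Measure ℝ)).map
        (fun p => ((p.2, decide (p.1 ≤ p.2)) : ℝ × Bool)) :=
    (Measure.pi_map_pi fun _ => measurable_observe_one.aemeasurable)
  rw [h1, map_observe_one, pi_withDensity_eq _ _ (measurable_obsDensity μ).ennreal_ofReal]
  congr 1
  ext z
  exact (ENNReal.ofReal_prod_of_nonneg fun _ _ => obsDensity_nonneg _ _).symm

lemma lintegral_fullLaw_observe (n : ℕ) (μ ν : ProbabilityMeasure ℝ)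
    {G : (Fin n → ℝ × Bool) → ℝ≥0∞} (hG : Measurable G) :
    ∫⁻ ω, G (observe ω) ∂(fullLaw n μ ν) =
      ∫⁻ z, ENNReal.ofReal (sampleDensity n μ z) * G z ∂(sampleRef n ν) := by
  rw [← lintegral_map hG measurable_observe, map_observe,
    lintegral_withDensity_eq_lintegral_mul _ (measurable_sampleDensity n μ).ennreal_ofReal hG]
  rfl

lemma lintegral_sampleDensity (n : ℕ) (μ ν : ProbabilityMeasure ℝ) :
    ∫⁻ z, ENNReal.ofReal (sampleDensity n μ z) ∂(sampleRef n ν) = 1 := by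
  have hp : IsProbabilityMeasure (fullLaw n μ ν) := by unfold fullLaw; infer_instance
  have := lintegral_fullLaw_observe n μ ν (G := fun _ => 1) measurable_const
  simpa using this.symm

/-! ### Hellinger affinity -/

/-- The geometric mean dominates the harmonic mean `2xy/(x+y) = (x+y)/2 - (x-y)²/(2(x+y))`, and `x +
y ≥ ε`. This is applied to `(a, b)` and to `(1 - a, 1 - b)`, where `1 - a ≥ 1/2 ≥ a ≥ ε/2`. -/
lemma one_sub_sq_div_le_sqrt_mul_add {ε a b : ℝ} (hε : 0 < ε) (ha : ε / 2 ≤ a) (hb : ε / 2 ≤ b)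
    (ha1 : a ≤ 1 / 2) (hb1 : b ≤ 1 / 2) :
    1 - (a - b) ^ 2 / ε ≤ √(a * b) + √((1 - a) * (1 - b)) := by
  have key : ∀ x y : ℝ, ε / 2 ≤ x → ε / 2 ≤ y →
      (x + y) / 2 - (x - y) ^ 2 / (2 * ε) ≤ √(x * y) := fun x y hx hy => by
    have hx0 : 0 ≤ x := by linarith
    have hy0 : 0 ≤ y := by linarith
    have h2 : (x - y) ^ 2 / (2 * (x + y)) ≤ (x - y) ^ 2 / (2 * ε) := by
      gcongr; linarith
    have h3 : 0 < x + y := by linarith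
    refine Real.le_sqrt_of_sq_le ?_ |>.trans' (sub_le_sub_left h2 _)
    have e : (x + y) / 2 - (x - y) ^ 2 / (2 * (x + y)) = 2 * (x * y) / (x + y) := by
      field_simp; ring
    rw [e, div_pow, div_le_iff₀ (by positivity)]
    have : 0 ≤ x * y := by positivity
    nlinarith [mul_nonneg this (sq_nonneg (x - y))]
  have h1 := key a b ha hb
  have h2 := key (1 - a) (1 - b) (by linarith) (by linarith)
  have e : (a - b) ^ 2 / ε = (a - b) ^ 2 / (2 * ε) + (1 - a - (1 - b)) ^ 2 / (2 * ε) := by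
    field_simp; ring
  rw [e]
  linarith

/-- Bernoulli's inequality, in additive form to avoid truncated subtraction in `ℝ≥0∞`. -/
lemma one_le_pow_add_of_one_le_add {A : ℝ≥0∞} {x : ℝ} (hx : 0 ≤ x)
    (h : 1 ≤ A + ENNReal.ofReal x) (n : ℕ) : 1 ≤ A ^ n + n * ENNReal.ofReal x := by
  rcases le_total 1 A with hA | hA
  · exact le_add_right (one_le_pow₀ hA)
  · have hAtop : A ≠ ⊤ := ne_top_of_le_ne_top ENNReal.one_ne_top hA
    lift A to NNReal using hAtop
    have h' : (1 : ℝ) ≤ A + x := by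
      rw [← ENNReal.ofReal_coe_nnreal, ← ENNReal.ofReal_add A.coe_nonneg hx, ENNReal.one_le_ofReal] at h
      exact h
    have hb := one_add_mul_le_pow (a := (A : ℝ) - 1) (by linarith [A.coe_nonneg]) n
    have hn : (0 : ℝ) ≤ n := Nat.cast_nonneg n
    rw [← ENNReal.ofReal_coe_nnreal, ← ENNReal.ofReal_pow A.coe_nonneg, ← ENNReal.ofReal_natCast,
      ← ENNReal.ofReal_mul hn, ← ENNReal.ofReal_add (by positivity) (by positivity),
      ENNReal.one_le_ofReal]
    have : (1 : ℝ) + (A - 1) = A := by ring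
    rw [this] at hb
    nlinarith

lemma one_le_affinity_add (n : ℕ) (μ μ' ν : ProbabilityMeasure ℝ) {ε γ : ℝ} (hε : 0 < ε)
    {I : Set ℝ} (hI : MeasurableSet I)
    (hout : ∀ t ∉ I, cdf (μ' : Measure ℝ) t = cdf (μ : Measure ℝ) t)
    (hin : ∀ t ∈ I, ε / 2 ≤ cdf (μ : Measure ℝ) t ∧ cdf (μ : Measure ℝ) t ≤ 1 / 2)
    (hin' : ∀ t ∈ I, ε / 2 ≤ cdf (μ' : Measure ℝ) t ∧ cdf (μ' : Measure ℝ) t ≤ 1 / 2)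
    (hdiff : ∀ t ∈ I, (cdf (μ : Measure ℝ) t - cdf (μ' : Measure ℝ) t) ^ 2 ≤ γ ^ 2) :
    1 ≤ ∫⁻ z, ENNReal.ofReal (√(sampleDensity n μ z * sampleDensity n μ' z)) ∂(sampleRef n ν) +
      ENNReal.ofReal (n * (γ ^ 2 / ε) * (ν : Measure ℝ).real I) := by
  set f : ℝ × Bool → ℝ≥0∞ := fun z => ENNReal.ofReal (√(obsDensity μ z * obsDensity μ' z)) with hf
  have hfm : Measurable f :=
    ((measurable_obsDensity μ).mul (measurable_obsDensity μ')).sqrt.ennreal_ofReal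
  have hprod : ∀ z : Fin n → ℝ × Bool,
      ENNReal.ofReal (√(sampleDensity n μ z * sampleDensity n μ' z)) = ∏ i, f (z i) := fun z => by
    simp only [hf, sampleDensity]
    rw [← ENNReal.ofReal_prod_of_nonneg fun _ _ => Real.sqrt_nonneg _, ← Finset.prod_mul_distrib,
      Real.sqrt_prod _ fun i _ => mul_nonneg (obsDensity_nonneg _ _) (obsDensity_nonneg _ _)]
  simp only [hprod, sampleRef]
  rw [lintegral_pi_prod_eq_prod _ n fun _ => hfm, Finset.prod_const, Finset.card_univ,
    Fintype.card_fin, mul_assoc, ENNReal.ofReal_mul (Nat.cast_nonneg n), ENNReal.ofReal_natCast]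
  refine one_le_pow_add_of_one_le_add (by positivity) ?_ n
  -- Off `I` the two c.d.f.s agree and the affinity given `T = t` is `F t + (1 - F t) = 1`; only `t
  -- ∈ I` loses anything.
  have hpt : ∀ t : ℝ, 1 ≤ (f (t, true) + f (t, false)) +
      I.indicator (fun _ => ENNReal.ofReal (γ ^ 2 / ε)) t := fun t => by
    simp only [hf, obsDensity, if_true, Bool.false_eq_true, if_false]
    rw [← ENNReal.ofReal_add (Real.sqrt_nonneg _) (Real.sqrt_nonneg _)]
    by_cases ht : t ∈ I
    · rw [Set.indicator_of_mem ht,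
        ← ENNReal.ofReal_add (by positivity) (by positivity), ENNReal.one_le_ofReal]
      have h1 := one_sub_sq_div_le_sqrt_mul_add hε (hin t ht).1 (hin' t ht).1 (hin t ht).2
        (hin' t ht).2
      have h2 := div_le_div_of_nonneg_right (hdiff t ht) hε.le
      linarith
    · rw [Set.indicator_of_notMem ht, add_zero, ENNReal.one_le_ofReal, hout t ht,
        Real.sqrt_mul_self (cdf_nonneg _ _),
        Real.sqrt_mul_self (by linarith [cdf_le_one (μ : Measure ℝ) t])]
      linarith
  have hft : Measurable fun t => f (t, true) + f (t, false) :=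
    (hfm.comp (measurable_id.prodMk measurable_const)).add
      (hfm.comp (measurable_id.prodMk measurable_const))
  calc (1 : ℝ≥0∞) = ∫⁻ _, 1 ∂(ν : Measure ℝ) := by simp
    _ ≤ ∫⁻ t, ((f (t, true) + f (t, false)) +
        I.indicator (fun _ => ENNReal.ofReal (γ ^ 2 / ε)) t) ∂(ν : Measure ℝ) :=
      lintegral_mono hpt
    _ = _ := by
      rw [lintegral_add_left hft, lintegral_prod_count_bool ν hfm, lintegral_indicator hI,
        setLIntegral_const, ENNReal.ofReal_mul (by positivity), ofReal_measureReal]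

/-! ### Two-point lower bound -/

/-- Minimizing over `x` leaves `pq/(p+q) * (a-b)²`, and `√(pq) ≤ pq/(p+q) + (p+q)/4` by AM-GM.
Multiplied by `p + q`, the gap is an explicit sum of two squares. After integration the last term
becomes half of the squared separation, as `p` and `q` have mass 1. -/
lemma sq_mul_sqrt_mul_le {p q : ℝ} (hp : 0 ≤ p) (hq : 0 ≤ q) (x a b : ℝ) :
    (a - b) ^ 2 * √(p * q) ≤
      p * (x - a) ^ 2 + q * (x - b) ^ 2 + (p + q) * ((a - b) ^ 2 / 4) := by
  obtain ⟨s, hs, rfl⟩ : ∃ s, 0 ≤ s ∧ s ^ 2 = p := ⟨√p, Real.sqrt_nonneg _, Real.sq_sqrt hp⟩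
  obtain ⟨t, ht, rfl⟩ : ∃ t, 0 ≤ t ∧ t ^ 2 = q := ⟨√q, Real.sqrt_nonneg _, Real.sq_sqrt hq⟩
  rw [← mul_pow, Real.sqrt_sq (by positivity)]
  rcases (add_nonneg (sq_nonneg s) (sq_nonneg t)).eq_or_lt with h0 | hpos
  · have hs0 : s = 0 := by nlinarith
    have ht0 : t = 0 := by nlinarith
    simp [hs0, ht0]
  · rw [← sub_nonneg]
    refine (mul_nonneg_iff_of_pos_left hpos).1 ?_
    have e : (s ^ 2 + t ^ 2) * (s ^ 2 * (x - a) ^ 2 + t ^ 2 * (x - b) ^ 2 +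
        (s ^ 2 + t ^ 2) * ((a - b) ^ 2 / 4) - (a - b) ^ 2 * (s * t)) =
        (s ^ 2 * (x - a) + t ^ 2 * (x - b)) ^ 2 +
          ((a - b) * (s * t - (s ^ 2 + t ^ 2) / 2)) ^ 2 := by ring
    rw [e]
    positivity

/-- The contribution of the points of `J` to the risk. -/
noncomputable def riskOn (n : ℕ) (μ ν : ProbabilityMeasure ℝ) (Fhat : (Fin n → ℝ × Bool) → ℝ → ℝ)
    (J : Set ℝ) : ℝ≥0∞ :=
  ∫⁻ ω, ∫⁻ u in J, ENNReal.ofReal ((Fhat (observe ω) u - cdf (μ : Measure ℝ) u) ^ 2)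
    ∂volume ∂(fullLaw n μ ν)

section riskOn

variable {n : ℕ} {Fhat : (Fin n → ℝ × Bool) → ℝ → ℝ}

lemma measurable_sq_error (hF : Measurable (Function.uncurry Fhat)) (μ : ProbabilityMeasure ℝ) :
    Measurable (Function.uncurry fun z u =>
      ENNReal.ofReal ((Fhat z u - cdf (μ : Measure ℝ) u) ^ 2)) :=
  ((hF.sub ((measurable_cdf μ).comp measurable_snd)).pow_const 2).ennreal_ofReal

lemma measurable_error_on (hF : Measurable (Function.uncurry Fhat)) (μ : ProbabilityMeasure ℝ)
    (J : Set ℝ) : Measurable fun z => ∫⁻ u in J,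
      ENNReal.ofReal ((Fhat z u - cdf (μ : Measure ℝ) u) ^ 2) :=
  (measurable_sq_error hF μ).lintegral_prod_right'

lemma sum_riskOn_le_risk (hF : Measurable (Function.uncurry Fhat)) (μ ν : ProbabilityMeasure ℝ)
    {ι : Type*} [Fintype ι] {J : ι → Set ℝ} (hJ : ∀ k, MeasurableSet (J k))
    (hdisj : Pairwise fun j k => Disjoint (J j) (J k)) (hsub : ∀ k, J k ⊆ Set.Icc 0 1) :
    ∑ k, riskOn n μ ν Fhat (J k) ≤ risk n μ ν Fhat := by
  unfold riskOn risk
  rw [← lintegral_finsetSum (f := fun k ω => ∫⁻ u in J k,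
    ENNReal.ofReal ((Fhat (observe ω) u - cdf (μ : Measure ℝ) u) ^ 2)) _
    fun k _ => (measurable_error_on hF μ (J k)).comp measurable_observe]
  refine lintegral_mono fun ω => ?_
  rw [← lintegral_biUnion_finset (fun j _ k _ h => hdisj h) fun k _ => hJ k]
  exact lintegral_mono_set (Set.iUnion₂_subset fun k _ => hsub k)

lemma ofReal_mul_affinity_le (hF : Measurable (Function.uncurry Fhat))
    (μ μ' ν : ProbabilityMeasure ℝ) {J : Set ℝ} (hJ : MeasurableSet J) {d : ℝ}
    (hd : ∀ u ∈ J, (cdf (μ : Measure ℝ) u - cdf (μ' : Measure ℝ) u) ^ 2 = d ^ 2) :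
    ENNReal.ofReal (d ^ 2) * volume J *
        ∫⁻ z, ENNReal.ofReal (√(sampleDensity n μ z * sampleDensity n μ' z)) ∂(sampleRef n ν) ≤
      riskOn n μ ν Fhat J + riskOn n μ' ν Fhat J +
        ENNReal.ofReal (d ^ 2) * volume J * ENNReal.ofReal (1 / 2) := by
  set p := sampleDensity n μ
  set q := sampleDensity n μ'
  have hp := sampleDensity_nonneg n μ
  have hq := sampleDensity_nonneg n μ'
  have hpm : Measurable p := measurable_sampleDensity n μ
  have hqm : Measurable q := measurable_sampleDensity n μ'
  set R := fun z => ∫⁻ u in J, ENNReal.ofReal ((Fhat z u - cdf (μ : Measure ℝ) u) ^ 2)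
  set R' := fun z => ∫⁻ u in J, ENNReal.ofReal ((Fhat z u - cdf (μ' : Measure ℝ) u) ^ 2)
  have hR : Measurable R := measurable_error_on hF μ J
  have hR' : Measurable R' := measurable_error_on hF μ' J
  have hpt : ∀ z, ENNReal.ofReal (√(p z * q z)) * (ENNReal.ofReal (d ^ 2) * volume J) ≤
      ENNReal.ofReal (p z) * R z + ENNReal.ofReal (q z) * R' z +
        (ENNReal.ofReal (p z) + ENNReal.ofReal (q z)) *
          (ENNReal.ofReal (d ^ 2 / 4) * volume J) := fun z => by
    have hFz : Measurable (Fhat z) := hF.comp measurable_prodMk_left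
    have m1 : Measurable fun u => ENNReal.ofReal ((Fhat z u - cdf (μ : Measure ℝ) u) ^ 2) :=
      ((hFz.sub (measurable_cdf μ)).pow_const 2).ennreal_ofReal
    have m2 : Measurable fun u => ENNReal.ofReal ((Fhat z u - cdf (μ' : Measure ℝ) u) ^ 2) :=
      ((hFz.sub (measurable_cdf μ')).pow_const 2).ennreal_ofReal
    calc _ = ∫⁻ _ in J, ENNReal.ofReal (√(p z * q z)) * ENNReal.ofReal (d ^ 2) := by
          rw [setLIntegral_const, mul_assoc]
      _ ≤ ∫⁻ u in J, (ENNReal.ofReal (p z) *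
            ENNReal.ofReal ((Fhat z u - cdf (μ : Measure ℝ) u) ^ 2) + ENNReal.ofReal (q z) *
            ENNReal.ofReal ((Fhat z u - cdf (μ' : Measure ℝ) u) ^ 2) +
            (ENNReal.ofReal (p z) + ENNReal.ofReal (q z)) * ENNReal.ofReal (d ^ 2 / 4)) := by
          refine setLIntegral_mono' hJ fun u hu => ?_
          rw [← ENNReal.ofReal_mul (Real.sqrt_nonneg _), ← ENNReal.ofReal_mul (hp z),
            ← ENNReal.ofReal_mul (hq z), ← ENNReal.ofReal_add (hp z) (hq z),
            ← ENNReal.ofReal_mul (add_nonneg (hp z) (hq z)),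
            ← ENNReal.ofReal_add (mul_nonneg (hp z) (sq_nonneg _))
              (mul_nonneg (hq z) (sq_nonneg _)),
            ← ENNReal.ofReal_add (add_nonneg (mul_nonneg (hp z) (sq_nonneg _))
              (mul_nonneg (hq z) (sq_nonneg _)))
              (mul_nonneg (add_nonneg (hp z) (hq z)) (by positivity))]
          refine ENNReal.ofReal_le_ofReal ?_
          have := sq_mul_sqrt_mul_le (hp z) (hq z) (Fhat z u) (cdf (μ : Measure ℝ) u)
            (cdf (μ' : Measure ℝ) u)
          rw [hd u hu] at this
          rwa [mul_comm]
      _ = _ := by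
          rw [lintegral_add_right _ measurable_const, lintegral_add_left (m1.const_mul _),
            lintegral_const_mul _ m1, lintegral_const_mul _ m2, setLIntegral_const, mul_assoc]
  have e1 : riskOn n μ ν Fhat J = ∫⁻ z, ENNReal.ofReal (p z) * R z ∂(sampleRef n ν) :=
    lintegral_fullLaw_observe n μ ν hR
  have e2 : riskOn n μ' ν Fhat J = ∫⁻ z, ENNReal.ofReal (q z) * R' z ∂(sampleRef n ν) :=
    lintegral_fullLaw_observe n μ' ν hR'
  rw [mul_comm, ← lintegral_mul_const _ (by fun_prop)]
  refine (lintegral_mono hpt).trans (le_of_eq ?_)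
  rw [lintegral_add_left (by fun_prop), lintegral_add_left (by fun_prop),
    lintegral_mul_const _ (by fun_prop), lintegral_add_left (by fun_prop),
    lintegral_sampleDensity, lintegral_sampleDensity, e1, e2]
  congr 1
  have : d ^ 2 / 4 = d ^ 2 * (1 / 4) := by ring
  have h2 : (1 : ℝ≥0∞) + 1 = ENNReal.ofReal 2 := by norm_num
  rw [this, ENNReal.ofReal_mul (sq_nonneg d), h2,
    show (1 / 2 : ℝ) = 2 * (1 / 4) by norm_num, ENNReal.ofReal_mul zero_le_two]
  ring

end riskOn

/-! ### Assouad's lemma -/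

/-- Flipping the `k`-th coordinate of a vertex of the hypercube. -/
def flip {m : ℕ} (k : Fin m) (w : Fin m → Bool) : Fin m → Bool :=
  Function.update w k (!w k)

lemma flip_involutive {m : ℕ} (k : Fin m) : Function.Involutive (flip k) := fun w => by
  simp [flip]

/-- Flipping permutes the vertices, so summing `h` over `w` counts each `a k w` twice. Only the sum
of the `x k` has to be small: `m δ ≤ 2 s + m δ / 2 + m δ / 4` on average over `w`. -/
lemma mul_div_eight_le_of_flip {m : ℕ} {a : Fin m → (Fin m → Bool) → ℝ} {x : Fin m → ℝ} {s δ : ℝ}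
    (hδ : 0 ≤ δ) (ha : ∀ w, ∑ k, a k w ≤ s) (hx : ∑ k, x k ≤ m / 4)
    (h : ∀ k w, δ ≤ a k w + a k (flip k w) + δ / 2 + δ * x k) : m * δ / 8 ≤ s := by
  set C : ℝ := (Fintype.card (Fin m → Bool) : ℝ) with hCdef
  have hC : 0 < C := by
    rw [hCdef]
    exact_mod_cast Fintype.card_pos
  have h1 : ∑ k, ∑ w, a k w ≤ C * s := by
    rw [Finset.sum_comm]
    simpa [hCdef] using Finset.sum_le_sum fun w (_ : w ∈ Finset.univ) => ha w
  have h2 : ∀ k, ∑ w, a k (flip k w) = ∑ w, a k w := fun k =>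
    Equiv.sum_comp (flip_involutive k).toPerm (a k)
  have h3 : ∑ _k : Fin m, ∑ _w : Fin m → Bool, δ ≤
      ∑ k, ∑ w, (a k w + a k (flip k w) + δ / 2 + δ * x k) :=
    Finset.sum_le_sum fun k _ => Finset.sum_le_sum fun w _ => h k w
  have h4 : ∑ k, ∑ w, (a k w + a k (flip k w) + δ / 2 + δ * x k) =
      2 * ∑ k, ∑ w, a k w + C * (m * (δ / 2) + δ * ∑ k, x k) := by
    simp only [Finset.sum_add_distrib, h2, Finset.sum_const, Finset.card_univ, nsmul_eq_mul,
      Fintype.card_fin, ← Finset.mul_sum]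
    simp only [hCdef]
    ring
  have h5 : ∑ _k : Fin m, ∑ _w : Fin m → Bool, δ = C * (m * δ) := by
    simp [hCdef]
    ring
  rw [h4, h5] at h3
  have h6 : δ * ∑ k, x k ≤ δ * (m / 4) := mul_le_mul_of_nonneg_left hx hδ
  have h7 : C * (m * δ) ≤ C * (2 * s + (m * (δ / 2) + δ * (m / 4))) := by nlinarith
  linarith [le_of_mul_le_mul_left h7 hC]

lemma sum_measureReal_cell_le_one (m : ℕ) (ν : ProbabilityMeasure ℝ) :
    ∑ k : Fin m, (ν : Measure ℝ).real (cell m k) ≤ 1 := by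
  rw [← measureReal_biUnion_finset
    (fun j _ k _ h => disjoint_cell (fun e => h (Fin.ext e))) fun k _ => measurableSet_cell m k]
  exact measureReal_le_one

/-- Information is measured by `ν` on whole cells, where the c.d.f.s may differ, and loss by
Lebesgue measure on the cores, where they differ by exactly `γ` in absolute value. Each core has
length `1 / (8 * m)`, which gives `γ ^ 2 / 64` after the factor `m / 8`. -/
lemma ofReal_sq_div_le_iSup_risk {m n : ℕ} (hm : 0 < m) {ε γ : ℝ} (hε : 0 < ε)
    {𝒞 : Set (ProbabilityMeasure ℝ)} {μ : (Fin m → Bool) → ProbabilityMeasure ℝ}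
    (hμ : ∀ w, μ w ∈ 𝒞)
    (hout : ∀ (w w' : Fin m → Bool) (k : Fin m), (∀ j, j ≠ k → w' j = w j) → ∀ t, t ∉ cell m k →
      cdf (μ w' : Measure ℝ) t = cdf (μ w : Measure ℝ) t)
    (hin : ∀ (w : Fin m → Bool) (k : Fin m), ∀ t ∈ cell m k,
      ε / 2 ≤ cdf (μ w : Measure ℝ) t ∧ cdf (μ w : Measure ℝ) t ≤ 1 / 2)
    (hdiff : ∀ (w w' : Fin m → Bool) (k : Fin m), ∀ t ∈ cell m k,
      (cdf (μ w : Measure ℝ) t - cdf (μ w' : Measure ℝ) t) ^ 2 ≤ γ ^ 2)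
    (hcore : ∀ (w w' : Fin m → Bool) (k : Fin m), w k ≠ w' k → ∀ t ∈ cellCore m k,
      (cdf (μ w : Measure ℝ) t - cdf (μ w' : Measure ℝ) t) ^ 2 = γ ^ 2)
    (hnγ : n * (γ ^ 2 / ε) ≤ m / 4) (ν : ProbabilityMeasure ℝ)
    {Fhat : (Fin n → ℝ × Bool) → ℝ → ℝ} (hF : Measurable (Function.uncurry Fhat)) :
    ENNReal.ofReal (γ ^ 2 / 64) ≤ ⨆ μ ∈ 𝒞, risk n μ ν Fhat := by
  set S := ⨆ μ ∈ 𝒞, risk n μ ν Fhat with hS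
  -- With `S` finite, every local risk is finite and the averaging can be done in `ℝ`.
  by_cases hStop : S = ⊤
  · simp [hStop]
  have hm' : (0 : ℝ) < m := by exact_mod_cast hm
  have hsub : ∀ k : Fin m, cellCore m k ⊆ Set.Icc 0 1 := fun k =>
    (cellCore_subset_cell m k).trans ((cell_subset_Icc k.2).trans
      (Set.Icc_subset_Icc_left (by norm_num)))
  have hdisj : Pairwise fun j k : Fin m => Disjoint (cellCore m j) (cellCore m k) :=
    fun j k h => (disjoint_cell (fun e => h (Fin.ext e))).mono (cellCore_subset_cell m j)
      (cellCore_subset_cell m k)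
  have hsum : ∀ w, ∑ k : Fin m, riskOn n (μ w) ν Fhat (cellCore m k) ≤ S := fun w =>
    (sum_riskOn_le_risk hF (μ w) ν (J := fun k : Fin m => cellCore m k)
      (fun k => measurableSet_cellCore m k) hdisj hsub).trans
      (le_iSup₂ (f := fun μ (_ : μ ∈ 𝒞) => risk n μ ν Fhat) (μ w) (hμ w))
  have hfin : ∀ (w) (k : Fin m), riskOn n (μ w) ν Fhat (cellCore m k) ≠ ⊤ := fun w k =>
    ne_top_of_le_ne_top hStop ((Finset.single_le_sum
      (f := fun k : Fin m => riskOn n (μ w) ν Fhat (cellCore m k))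
      (fun _ _ => bot_le) (Finset.mem_univ k)).trans (hsum w))
  set δ := γ ^ 2 / (8 * m) with hδ
  have hδ0 : 0 ≤ δ := by positivity
  rw [← ENNReal.ofReal_toReal hStop]
  refine ENNReal.ofReal_le_ofReal ?_
  have e : γ ^ 2 / 64 = m * δ / 8 := by rw [hδ]; field_simp; norm_num
  rw [e]
  refine mul_div_eight_le_of_flip
    (a := fun k w => (riskOn n (μ w) ν Fhat (cellCore m k)).toReal)
    (x := fun k => n * (γ ^ 2 / ε) * (ν : Measure ℝ).real (cell m k)) hδ0 (fun w => ?_) ?_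
    fun k w => ?_
  · rw [← ENNReal.toReal_sum fun k _ => hfin w k]
    exact ENNReal.toReal_mono hStop (hsum w)
  · rw [← Finset.mul_sum]
    exact (mul_le_of_le_one_right (by positivity) (sum_measureReal_cell_le_one m ν)).trans hnγ
  · have hx0 : 0 ≤ n * (γ ^ 2 / ε) * (ν : Measure ℝ).real (cell m k) := by positivity
    have h1 := one_le_affinity_add n (μ w) (μ (flip k w)) ν hε (measurableSet_cell m k)
      (hout w (flip k w) k fun j hj => by simp [flip, hj]) (hin w k) (hin _ k) (hdiff w _ k)
    have h2 := ofReal_mul_affinity_le hF (μ w) (μ (flip k w)) ν (measurableSet_cellCore m k)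
      (hcore w (flip k w) k (by simp [flip]))
    have hvol : ENNReal.ofReal (γ ^ 2) * volume (cellCore m k) = ENNReal.ofReal δ := by
      rw [volume_cellCore hm, ← ENNReal.ofReal_mul (sq_nonneg γ), hδ, mul_one_div]
    rw [hvol] at h2
    have h3 : ENNReal.ofReal δ ≤ riskOn n (μ w) ν Fhat (cellCore m k) +
        riskOn n (μ (flip k w)) ν Fhat (cellCore m k) + ENNReal.ofReal δ * ENNReal.ofReal (1 / 2) +
        ENNReal.ofReal δ *
          ENNReal.ofReal (n * (γ ^ 2 / ε) * (ν : Measure ℝ).real (cell m k)) := by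
      refine le_trans ?_ (add_le_add_left h2 _)
      rw [← mul_add]
      exact le_mul_of_one_le_right' h1
    rw [← ENNReal.ofReal_toReal (hfin w k), ← ENNReal.ofReal_toReal (hfin (flip k w) k),
      ← ENNReal.ofReal_mul hδ0, ← ENNReal.ofReal_mul hδ0,
      ← ENNReal.ofReal_add ENNReal.toReal_nonneg ENNReal.toReal_nonneg,
      ← ENNReal.ofReal_add (by positivity) (by positivity),
      ← ENNReal.ofReal_add (by positivity) (by positivity),
      ENNReal.ofReal_le_ofReal_iff (by positivity)] at h3
    simpa [div_eq_mul_inv] using h3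

/-! ### Choice of the resolution and conclusion. -/

lemma exists_resolution {β : ℝ} (hβ : 0 < β) {n : ℕ} (hn : 1 ≤ n) :
    ∃ m : ℕ, 0 < m ∧ n * ((2 * m : ℝ) ^ (-β)) ^ 2 ≤ m ∧
      4 ^ (-(2 * β)) * (n : ℝ) ^ (-(2 * β / (2 * β + 1))) ≤ ((2 * m : ℝ) ^ (-β)) ^ 2 := by
  have hn1 : (1 : ℝ) ≤ n := by exact_mod_cast hn
  set y := (n : ℝ) ^ (1 / (2 * β + 1)) with hy
  have hy1 : 1 ≤ y := Real.one_le_rpow hn1 (by positivity)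
  have hyn : y ^ (2 * β + 1) = n := by
    rw [hy, ← Real.rpow_mul (by positivity), one_div_mul_cancel (by positivity), Real.rpow_one]
  have hle : y ≤ ⌈y⌉₊ := Nat.le_ceil y
  have hm0 : (0 : ℝ) < ⌈y⌉₊ := by linarith
  have hsq : ((2 * ⌈y⌉₊ : ℝ) ^ (-β)) ^ 2 = (2 * ⌈y⌉₊ : ℝ) ^ (-(2 * β)) := by
    rw [← Real.rpow_natCast, ← Real.rpow_mul (by positivity)]
    congr 1
    push_cast
    ring
  -- Here `y ^ (2 * β + 1) = n` balances `n m^(-2β)` against `m`. Rounding up costs a constant: `2 *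
  -- ⌈y⌉₊ ≤ 4 * y` because `y ≥ 1`, whence the factor `4 ^ (-(2 * β))`.
  refine ⟨⌈y⌉₊, by exact_mod_cast hm0, ?_, ?_⟩
  · rw [hsq]
    calc n * (2 * ⌈y⌉₊ : ℝ) ^ (-(2 * β))
        ≤ (⌈y⌉₊ : ℝ) ^ (2 * β + 1) * (⌈y⌉₊ : ℝ) ^ (-(2 * β)) := by
          rw [← hyn]
          refine mul_le_mul (Real.rpow_le_rpow (by linarith) hle (by positivity)) ?_
            (by positivity) (by positivity)
          exact Real.rpow_le_rpow_of_nonpos hm0 (by linarith) (by linarith)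
      _ = ⌈y⌉₊ := by
          rw [← Real.rpow_add hm0]
          simp
  · rw [hsq]
    have hpow : (n : ℝ) ^ (-(2 * β / (2 * β + 1))) = y ^ (-(2 * β)) := by
      rw [hy, ← Real.rpow_mul (by positivity)]
      congr 1
      ring
    rw [hpow, ← Real.mul_rpow (by norm_num) (by linarith)]
    refine Real.rpow_le_rpow_of_nonpos (by positivity) ?_ (by linarith)
    linarith [Nat.ceil_lt_add_one (show 0 ≤ y by linarith)]

end CurrentStatus

theorem mainTheorem5 (β L : ℝ) (hβ : 1 < β) (hL : 0 < L) :
    ∃ c : ℝ, 0 < c ∧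
      ∀ (ν : ProbabilityMeasure ℝ), (∀ᵐ t ∂(ν : Measure ℝ), 0 < t) →
        ∀ n : ℕ, 1 ≤ n →
          ENNReal.ofReal (c * (n : ℝ) ^ (-(2 * β / (2 * β + 1)))) ≤
            CurrentStatus.minimaxRisk n β L ν := by
  obtain ⟨ε, c, hε, hc, hcε, hcube⟩ := CurrentStatus.exists_hypercube_of_laws hβ hL
  refine ⟨c ^ 2 * 4 ^ (-(2 * β)) / 64, by positivity, fun ν _ n hn => ?_⟩
  obtain ⟨m, hm, hnm, hrate⟩ := CurrentStatus.exists_resolution (zero_lt_one.trans hβ) hn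
  obtain ⟨μ, hμ, hout, hin, hdiff, hcore⟩ := hcube m hm
  refine le_iInf₂ fun Fhat hF => ?_
  refine le_trans (ENNReal.ofReal_le_ofReal ?_)
    (CurrentStatus.ofReal_sq_div_le_iSup_risk hm hε hμ hout hin hdiff hcore ?_ ν hF)
  · rw [mul_pow]
    linarith [mul_le_mul_of_nonneg_left hrate (sq_nonneg c)]
  · have hm0 : (0 : ℝ) ≤ m := Nat.cast_nonneg m
    calc _ = c ^ 2 / ε * (n * ((2 * m : ℝ) ^ (-β)) ^ 2) := by ring
      _ ≤ 1 / 4 * m := mul_le_mul hcε hnm (by positivity) (by norm_num)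
      _ = m / 4 := by ring
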